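/- Let $J$ be the symmetric matrix of the Minkowski form $\langle p,q\rangle=p_1q_1+p_2q_2-p_0q_3-p_3q_0$ on $\mathbb R^4$, let $G=\{\Theta\in O(3,1):\det\Theta=1\}$, where $O(3,1)=\{\Theta:\Theta^TJ\Theta=J\}$, let $\mathfrak g=\mathfrak o(3,1)$ be its Lie algebra, and let $H\subset G$ be the isotropy group of $e_4=(0,0,0,1)$. Fix $T>0$. We consider smooth curves $u:\mathbb R\to\mathbb R^4$ in the light cone ($\langle u,u\rangle=0$) that are star-shaped ($\|u'\|^2=\langle u',u'\rangle>0$) and have a monodromy $u(x+T)=m\,u(x)$ for some $m\in G$. *Invariants.* Let $\rho(x)\in G$ be the right moving frame along $u$ that is determined by $\rho u=e_4$, $\rho u'=\|u'\|e_2$, $(\rho u'')_2=0$ (the coordinate of $\rho u''$ with index $2$ in $(u_0,u_1,u_2,u_3)$). The left Maurer–Cartan matrix $K=\lambda^{-1}\lambda_x$, $\lambda=\rho^{-1}$, has the form $$K=K(k)=\begin{pmatrix}0&k_0&0&0\\k_1&0&0&k_0\\k_2&0&0&0\\0&k_1&k_2&0\end{pmatrix},\qquad k_0=\|u'\|,$$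 and its entries $k=(k_0,k_1,k_2)$ are the ($T$-periodic) differential invariants of $u$; $k_0$ is the arc-length invariant. Let $\mathcal K$ be the space of all smooth $T$-periodic $k=(k_0,k_1,k_2)$ with $k_0>0$. *Geometric Poisson bracket.* Let $U$ be the set of smooth $T$-periodic loops $L$ in $\mathfrak g$ with $\langle Le_4,Le_4\rangle>0$ everywhere. Smooth $T$-periodic loops $g$ in $H$ act on $U$ by the gauge action $L\mapsto g^{-1}Lg+g^{-1}g_x$. Functionals on $U$ and on $\mathcal K$ are assumed to have smooth $T$-periodic variational derivatives, on $U$ with respect to the pairing $\int_0^T\operatorname{trace}(XY)\,dx$. For two functionals $h,f$ on $\mathcal K$, $$\{h,f\}(k)=\int_0^T\operatorname{trace}\Big(\Big(\big(\tfrac{\delta\mathcal H}{\delta L}\big)_x+\big[K,\tfrac{\delta\mathcal H}{\delta L}\big]\Big)\tfrac{\delta\mathcal F}{\delta L}\Big)dx,\qquad K=K(k),$$ where $\mathcal H,\mathcal F$ are functionals on $U$ that extend $h,f$ and are constant on the gauge orbits, and the variational derivatives are taken at $K$. The Hamiltonian vector field $X_h$ of $h$ is defined by $df(k)(X_h(k))=\{h,f\}(k)$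 for all functionals $f$ on $\mathcal K$. *Statement.* Let $u_t=F(u,u',\dots,u^{(n)})$ be an evolution of star-shaped curves in the cone that is invariant, i.e. $G$ takes solutions to solutions (this holds in particular if all of $O(3,1)$ does). Here a solution is a family of curves as above, smooth in $(t,x)$, with $t$ in an open interval. 1. If there is a functional $h$ on $\mathcal K$ such that the invariants $k$ of every solution $u(t,x)$ satisfy $k_t=X_h(k)$, then the evolution preserves arc-length: $k_0(t,x)=\|u_x(t,x)\|$ does not depend on $t$ for any solution. 2. The same holds at the level of vector fields: if there is a functional $h$ on $\mathcal K$ such that for every smooth family $u(t,x)$ of curves as above and every time $t$ at which $u_t=F(u,u',\dots,u^{(n)})$ holds for all $x$ one has $k_t=X_h(k)$ at that time, then $(k_0)_t=0$ for all such families at all such times. -/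

import Mathlib

open scoped ContDiff

noncomputable section

namespace LightCone

/-! ## The Minkowski form, the Lorentz group and its Lie algebra -/

/-- Vectors of Lorentzian `ℝ⁴`, with coordinates `(u₀, u₁, u₂, u₃)`. -/
abbrev Vec : Type := Fin 4 → ℝ

/-- Real `4 × 4` matrices. -/
abbrev Mat : Type := Matrix (Fin 4) (Fin 4) ℝ

/-- The matrix of the Minkowski form. -/
def J : Mat := !![0, 0, 0, -1; 0, 1, 0, 0; 0, 0, 1, 0; -1, 0, 0, 0]

/-- The Minkowski product `pᵀ J q`. -/
def mink (p q : Vec) : ℝ := p ⬝ᵥ (J.mulVec q)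

/-- The orientation preserving Lorentz group `{Θ ∈ O(3,1) | det Θ = 1}`, where
`O(3,1) = {Θ | Θᵀ J Θ = J}`. -/
def SO31 : Set Mat := {g | g.transpose * J * g = J ∧ g.det = 1}

/-- The isotropy subgroup of `e₄ = (0, 0, 0, 1)`; the cone is the quotient by this subgroup. -/
def isotropy : Set Mat := {g | g ∈ SO31 ∧ g.mulVec ![0, 0, 0, 1] = ![0, 0, 0, 1]}

/-- The Lie algebra `o(3,1)`. -/
def so31 : Set Mat := {X | X.transpose * J + J * X = 0}

/-! ## The moving frame of a star-shaped cone curve and its invariants -/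

/-- The normalization equations `ρ u = e₄`, `ρ u' = ‖u'‖ e₂`, `(ρ u'')₃ = 0` for a right moving
frame, at the jet `(u, u', u'') = (p, q, r)`. -/
def IsNormalizedFrame (p q r : Vec) (ρ : Mat) : Prop :=
  ρ ∈ SO31 ∧ ρ.mulVec p = ![0, 0, 0, 1] ∧ ρ.mulVec q = ![0, √(mink q q), 0, 0] ∧
    ρ.mulVec r 2 = 0

/-- The Lorentzian cross product: `⟨cross a b c, v⟩ = det (a, b, v, c)` for all `v`. -/
def cross (a b c : Vec) : Vec :=
  J.mulVec fun j => (Matrix.of ![a, b, Pi.single j 1, c]).det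

/-- The unit tangent `u' / ‖u'‖`. -/
def tangentVec (q : Vec) : Vec := (√(mink q q))⁻¹ • q

/-- The null vector of the frame that is transversal to the cone. -/
def transVec (p q r : Vec) : Vec :=
  (mink q q)⁻¹ • (r - (mink q r / mink q q) • q -
    ((mink q r ^ 2 / mink q q - mink r r) / (2 * mink q q)) • p)

/-- The left moving frame at the jet `(u, u', u'') = (p, q, r)`: the inverse of the right moving
frame given by the normalization equations, see `isNormalizedFrame_iff`. -/
def leftFrameJet (p q r : Vec) : Mat :=
  (Matrix.of ![transVec p q r, tangentVec q,
    cross (transVec p q r) (tangentVec q) p, p]).transpose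

theorem det_of_rows (a b c d : Vec) : (Matrix.of ![a, b, c, d]).det =
    a 0 * (b 1 * (c 2 * d 3 - c 3 * d 2) - b 2 * (c 1 * d 3 - c 3 * d 1)
      + b 3 * (c 1 * d 2 - c 2 * d 1)) -
    a 1 * (b 0 * (c 2 * d 3 - c 3 * d 2) - b 2 * (c 0 * d 3 - c 3 * d 0)
      + b 3 * (c 0 * d 2 - c 2 * d 0)) +
    a 2 * (b 0 * (c 1 * d 3 - c 3 * d 1) - b 1 * (c 0 * d 3 - c 3 * d 0)
      + b 3 * (c 0 * d 1 - c 1 * d 0)) -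
    a 3 * (b 0 * (c 1 * d 2 - c 2 * d 1) - b 1 * (c 0 * d 2 - c 2 * d 0)
      + b 2 * (c 0 * d 1 - c 1 * d 0)) := by
  rw [Matrix.det_succ_row_zero]
  simp [Matrix.det_fin_three, Fin.sum_univ_four, Fin.succAbove]
  ring

theorem mink_apply (p q : Vec) :
    mink p q = p 1 * q 1 + p 2 * q 2 - p 0 * q 3 - p 3 * q 0 := by
  simp [mink, J, Matrix.mulVec, dotProduct, Fin.sum_univ_four]
  ring

theorem mink_cross (a b c d : Vec) : mink (cross a b c) d = (Matrix.of ![a, b, d, c]).det := by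
  simp only [mink_apply, cross, J, Matrix.mulVec, dotProduct, Fin.sum_univ_four, det_of_rows]
  simp
  ring

theorem mink_cross_cross (a b c : Vec) : mink (cross a b c) (cross a b c) =
    -(mink a a * (mink b b * mink c c - mink b c ^ 2) -
      mink a b * (mink a b * mink c c - mink b c * mink a c) +
      mink a c * (mink a b * mink b c - mink b b * mink a c)) := by
  simp only [mink_apply, cross, J, Matrix.mulVec, dotProduct, Fin.sum_univ_four, det_of_rows]
  simp
  ring

theorem mink_comm (a b : Vec) : mink a b = mink b a := by
  simp only [mink_apply]; ring

theorem mink_sub (a b c : Vec) : mink a (b - c) = mink a b - mink a c := by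
  simp [mink, Matrix.mulVec_sub]

theorem mink_smul (a b : Vec) (t : ℝ) : mink a (t • b) = t * mink a b := by
  simp [mink, Matrix.mulVec_smul]

theorem rows_gram (a b c d : Vec) :
    (Matrix.of ![a, b, c, d]) * J * (Matrix.of ![a, b, c, d]).transpose =
      Matrix.of fun i j => mink (![a, b, c, d] i) (![a, b, c, d] j) := by
  ext i j
  rw [Matrix.mul_assoc]
  simp only [Matrix.mul_apply, Matrix.of_apply, mink, dotProduct,
    Matrix.mulVec, Matrix.transpose_apply]

theorem J_mul_J : J * J = 1 := by
  ext i j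
  fin_cases i <;> fin_cases j <;> simp [J, Matrix.mul_apply, Fin.sum_univ_four]

theorem leftFrameJet_mem {p q r : Vec} (hp : mink p p = 0) (hpq : mink p q = 0)
    (hq : 0 < mink q q) (hpr : mink p r = -mink q q) : leftFrameJet p q r ∈ SO31 := by
  have hs : √(mink q q) ^ 2 = mink q q := Real.sq_sqrt hq.le
  have hs0 : 0 < √(mink q q) := Real.sqrt_pos.2 hq
  have hne := hq.ne'
  have hTT : mink (tangentVec q) (tangentVec q) = 1 := by
    have h2 : mink (tangentVec q) (tangentVec q) = mink q q / √(mink q q) ^ 2 := by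
      simp only [tangentVec, mink_apply, Pi.smul_apply, smul_eq_mul]; ring
    rw [h2, hs, div_self hne]
  have hTp : mink (tangentVec q) p = 0 := by
    rw [mink_comm, tangentVec, mink_smul, hpq, mul_zero]
  have hEp : mink (transVec p q r) p = -1 := by
    rw [mink_comm, transVec, mink_smul, mink_sub, mink_sub, mink_smul, mink_smul, hpr, hpq, hp]
    field_simp; ring
  have hqE : mink q (transVec p q r) = 0 := by
    rw [transVec, mink_smul, mink_sub, mink_sub, mink_smul, mink_smul, mink_comm q p, hpq]
    field_simp; ring
  have hET : mink (transVec p q r) (tangentVec q) = 0 := by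
    rw [tangentVec, mink_smul, mink_comm (transVec p q r) q, hqE, mul_zero]
  have hrE : mink r (transVec p q r) =
      (mink r r - mink q r ^ 2 / mink q q) / (2 * mink q q) := by
    rw [transVec, mink_smul, mink_sub, mink_sub, mink_smul, mink_smul, mink_comm r p, hpr,
      mink_comm r q]
    field_simp; ring
  have hEE : mink (transVec p q r) (transVec p q r) = 0 := by
    nth_rw 2 [transVec]
    rw [mink_smul, mink_sub, mink_sub, mink_smul, mink_smul]
    rw [mink_comm (transVec p q r) r, mink_comm (transVec p q r) q, hqE, hEp, hrE]
    field_simp; ring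
  set E := transVec p q r
  set t := tangentVec q
  have hN : mink (cross E t p) (cross E t p) = 1 := by
    rw [mink_cross_cross, hEE, hET, hEp, hTT, hTp, hp]; norm_num
  have hNE : mink (cross E t p) E = 0 := by rw [mink_cross, det_of_rows]; ring
  have hNt : mink (cross E t p) t = 0 := by rw [mink_cross, det_of_rows]; ring
  have hNp : mink (cross E t p) p = 0 := by rw [mink_cross, det_of_rows]; ring
  refine ⟨?_, ?_⟩
  · rw [leftFrameJet, Matrix.transpose_transpose, rows_gram]
    ext i j
    fin_cases i <;> fin_cases j <;>
      simp [J, E, t, hEE, hET, hEp, hTT, hTp, hp, hN, hNE, hNt, hNp, mink_comm p,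
        mink_comm _ (cross _ _ _), mink_comm (tangentVec q) (transVec p q r)]
  · rw [leftFrameJet, Matrix.det_transpose, ← mink_cross, hN]

/-- At the second jet of a star-shaped cone curve, the inverse of `leftFrameJet` is the unique
solution in `SO31` of the normalization equations. -/
theorem isNormalizedFrame_iff {p q r : Vec} (hp : mink p p = 0) (hpq : mink p q = 0)
    (hq : 0 < mink q q) (hpr : mink p r = -mink q q) (ρ : Mat) :
    IsNormalizedFrame p q r ρ ↔ ρ = (leftFrameJet p q r)⁻¹ := by
  obtain ⟨hl, hdet⟩ := leftFrameJet_mem hp hpq hq hpr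
  have hs0 : 0 < √(mink q q) := Real.sqrt_pos.2 hq
  have hne := hq.ne'
  have hunit : IsUnit (leftFrameJet p q r).det := by rw [hdet]; exact isUnit_one
  have c1 : (leftFrameJet p q r).mulVec ![0, 1, 0, 0] = (√(mink q q))⁻¹ • q := by
    ext i; simp [leftFrameJet, Matrix.mulVec, dotProduct, Fin.sum_univ_four, tangentVec]
  have c3 : (leftFrameJet p q r).mulVec ![0, 0, 0, 1] = p := by
    ext i; simp [leftFrameJet, Matrix.mulVec, dotProduct, Fin.sum_univ_four]
  have c0 : (leftFrameJet p q r).mulVec ![1, 0, 0, 0] = transVec p q r := by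
    ext i; simp [leftFrameJet, Matrix.mulVec, dotProduct, Fin.sum_univ_four]
  have hr : r = mink q q • transVec p q r + (mink q r / mink q q) • q +
      ((mink q r ^ 2 / mink q q - mink r r) / (2 * mink q q)) • p := by
    rw [transVec, smul_smul, mul_inv_cancel₀ hne, one_smul]; abel
  have hq' : q = √(mink q q) • ((√(mink q q))⁻¹ • q) := by
    rw [smul_smul, mul_inv_cancel₀ hs0.ne', one_smul]
  set A := leftFrameJet p q r with hA
  constructor
  · rintro ⟨⟨ho, hd⟩, h3, h1, h2⟩
    have e3 : (ρ * A).mulVec ![0, 0, 0, 1] = ![0, 0, 0, 1] := by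
      rw [← Matrix.mulVec_mulVec, c3, h3]
    have e1 : (ρ * A).mulVec ![0, 1, 0, 0] = ![0, 1, 0, 0] := by
      rw [← Matrix.mulVec_mulVec, c1, Matrix.mulVec_smul, h1]
      ext i; fin_cases i <;> simp [hs0.ne']
    have e0 : (ρ * A).mulVec ![1, 0, 0, 0] 2 = 0 := by
      rw [← Matrix.mulVec_mulVec, c0, transVec]
      simp [Matrix.mulVec_sub, Matrix.mulVec_smul, h1, h3]
      exact Or.inr h2
    have hO : (ρ * A).transpose * J * (ρ * A) = J := by
      rw [Matrix.transpose_mul]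
      calc _ = A.transpose * (ρ.transpose * J * ρ) * A := by simp only [Matrix.mul_assoc]
        _ = J := by rw [ho, hl]
    have hD : (ρ * A).det = 1 := by rw [Matrix.det_mul, hd, hdet, one_mul]
    generalize hM : ρ * A = M at e3 e1 e0 hO hD
    have m3 : ∀ i, M i 3 = ![0, 0, 0, 1] i := fun i => by
      rw [← e3]; simp [Matrix.mulVec, dotProduct, Fin.sum_univ_four]
    have m1 : ∀ i, M i 1 = ![0, 1, 0, 0] i := fun i => by
      rw [← e1]; simp [Matrix.mulVec, dotProduct, Fin.sum_univ_four]
    have m20 : M 2 0 = 0 := by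
      rw [← e0]; simp [Matrix.mulVec, dotProduct, Fin.sum_univ_four]
    have key : ∀ i j, (M.transpose * J * M) i j = J i j := fun i j => by rw [hO]
    have k03 := key 0 3
    have k01 := key 0 1
    have k00 := key 0 0
    have k23 := key 2 3
    have k21 := key 2 1
    have k20 := key 2 0
    simp [Matrix.mul_apply, J, Fin.sum_univ_four, m3, m1, m20] at k03 k01 k00 k23 k21 k20
    simp [k03, k01] at k00
    simp [k23, k21, k03, k01] at k20
    have m22 : M 2 2 = 1 := by
      have hM' : M = (Matrix.of ![M 0, M 1, M 2, M 3]) := by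
        ext i j; fin_cases i <;> rfl
      rw [hM', det_of_rows] at hD
      simpa [m3, m1, m20, k03, k01, k00, k23, k21, k20] using hD
    have : M = 1 := by
      ext i j
      fin_cases i <;> fin_cases j <;>
        simp [m3, m1, m20, k03, k01, k00, k23, k21, k20, m22]
    rw [this] at hM
    exact (Matrix.inv_eq_left_inv hM).symm
  · rintro rfl
    have hinv : ∀ v, A⁻¹.mulVec (A.mulVec v) = v := fun v => by
      rw [Matrix.mulVec_mulVec, Matrix.nonsing_inv_mul _ hunit, Matrix.one_mulVec]
    have h3 : A⁻¹.mulVec p = ![0, 0, 0, 1] := by rw [← c3, hinv]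
    have h1 : A⁻¹.mulVec q = ![0, √(mink q q), 0, 0] := by
      conv_lhs => rw [hq', Matrix.mulVec_smul, ← c1, hinv]
      ext i; fin_cases i <;> simp
    have h0 : A⁻¹.mulVec (transVec p q r) = ![1, 0, 0, 0] := by rw [← c0, hinv]
    refine ⟨⟨?_, ?_⟩, h3, h1, ?_⟩
    · have hAi : A * A⁻¹ = 1 := Matrix.mul_nonsing_inv _ hunit
      calc A⁻¹.transpose * J * A⁻¹ = A⁻¹.transpose * (A.transpose * J * A) * A⁻¹ := by rw [hl]
        _ = (A * A⁻¹).transpose * J * (A * A⁻¹) := by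
          simp only [Matrix.transpose_mul, Matrix.mul_assoc]
        _ = J := by rw [hAi]; simp
    · rw [Matrix.det_nonsing_inv, hdet]; simp
    · conv_lhs => rw [hr]
      simp only [Matrix.mulVec_add, Matrix.mulVec_smul, h0, h1, h3]
      simp

/-- Entrywise derivative of a matrix valued function. -/
def matDeriv (L : ℝ → Mat) (x : ℝ) : Mat := Matrix.of fun i j => deriv (fun y => L y i j) x

/-- The left moving frame along a curve. -/
def leftFrame (γ : ℝ → Vec) (x : ℝ) : Mat :=
  leftFrameJet (γ x) (deriv γ x) (iteratedDeriv 2 γ x)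

/-- The left Maurer-Cartan matrix `λ⁻¹ λₓ` of the left moving frame `λ`. -/
def maurerCartan (γ : ℝ → Vec) (x : ℝ) : Mat := (leftFrame γ x)⁻¹ * matDeriv (leftFrame γ) x

/-- The Maurer-Cartan matrix with invariants `k = (k₀, k₁, k₂)`. -/
def mcMatrix (k : Fin 3 → ℝ) : Mat :=
  !![0, k 0, 0, 0; k 1, 0, 0, k 0; k 2, 0, 0, 0; 0, k 1, k 2, 0]

/-- The differential invariants `(k₀, k₁, k₂)` of a star-shaped cone curve, read off from its
Maurer-Cartan matrix. -/
def invariants (γ : ℝ → Vec) (x : ℝ) : Fin 3 → ℝ :=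
  ![maurerCartan γ x 0 1, maurerCartan γ x 1 0, maurerCartan γ x 2 0]

/-- The arc-length invariant `k₀ = ‖u'‖`. -/
def arcLength (γ : ℝ → Vec) (x : ℝ) : ℝ := √(mink (deriv γ x) (deriv γ x))

/-! ## Curves in the cone and their evolutions -/

/-- Smooth star-shaped curves in the light cone with a group monodromy over the period `T`. -/
structure IsConeCurve (T : ℝ) (γ : ℝ → Vec) : Prop where
  smooth : ContDiff ℝ ∞ γ
  onCone : ∀ x, mink (γ x) (γ x) = 0
  starShaped : ∀ x, 0 < mink (deriv γ x) (deriv γ x)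
  monodromy : ∃ m ∈ SO31, ∀ x, γ (x + T) = m.mulVec (γ x)

/-- Smooth one-parameter families of star-shaped cone curves, with time in an open interval. -/
structure IsFlow (T : ℝ) (I : Set ℝ) (u : ℝ → ℝ → Vec) : Prop where
  isOpen : IsOpen I
  ordConnected : I.OrdConnected
  smooth : ContDiffOn ℝ ∞ (fun p : ℝ × ℝ => u p.1 p.2) (I ×ˢ Set.univ)
  curve : ∀ t ∈ I, IsConeCurve T (u t)

/-- The equation `u_t = F(u, u', …, u⁽ⁿ⁾)` at time `t`. -/
def EvolvesAt {n : ℕ} (F : (Fin (n + 1) → Vec) → Vec) (u : ℝ → ℝ → Vec) (t : ℝ) : Prop :=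
  ∀ x, HasDerivAt (fun s => u s x) (F fun i => iteratedDeriv i (u t) x) t

/-- Solutions of `u_t = F(u, u', …, u⁽ⁿ⁾)` among star-shaped cone curves. -/
def IsSolution {n : ℕ} (T : ℝ) (F : (Fin (n + 1) → Vec) → Vec) (I : Set ℝ)
    (u : ℝ → ℝ → Vec) : Prop :=
  IsFlow T I u ∧ ∀ t ∈ I, EvolvesAt F u t

/-- The evolution is invariant: the Lorentz group takes solutions to solutions. -/
def IsInvariantEvolution {n : ℕ} (T : ℝ) (F : (Fin (n + 1) → Vec) → Vec) : Prop :=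
  ∀ Θ ∈ SO31, ∀ (I : Set ℝ) (u : ℝ → ℝ → Vec), IsSolution T F I u →
    IsSolution T F I fun t x => Θ.mulVec (u t x)

/-! ## Loops in the Lie algebra, functionals and the Poisson bracket on them -/

/-- Smooth `T`-periodic loops of matrices. -/
def IsLoop (T : ℝ) (L : ℝ → Mat) : Prop :=
  (∀ i j, ContDiff ℝ ∞ fun x => L x i j) ∧ ∀ x, L (x + T) = L x

/-- Smooth loops in `o(3,1)`; the dual is identified with this space through the trace form. -/
def loopAlgebra (T : ℝ) : Set (ℝ → Mat) := {L | IsLoop T L ∧ ∀ x, L x ∈ so31}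

/-- The open set of those loops that are Maurer-Cartan matrices of left frames `g`, `g e₄ = u`,
along star-shaped curves `u`: since `u' = g L e₄`, the condition is `⟨L e₄, L e₄⟩ > 0`. -/
def regularLoops (T : ℝ) : Set (ℝ → Mat) :=
  {L | L ∈ loopAlgebra T ∧
    ∀ x, 0 < mink ((L x).mulVec ![0, 0, 0, 1]) ((L x).mulVec ![0, 0, 0, 1])}

/-- Smooth loops in the isotropy subgroup. -/
def loopIsotropy (T : ℝ) : Set (ℝ → Mat) := {g | IsLoop T g ∧ ∀ x, g x ∈ isotropy}

/-- The gauge action `L ↦ g⁻¹ L g + g⁻¹ gₓ`. -/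
def gauge (g L : ℝ → Mat) (x : ℝ) : Mat := (g x)⁻¹ * L x * g x + (g x)⁻¹ * matDeriv g x

/-- `X` is the variational derivative at `L₀` of the functional `H` on regular loops: for every
smooth family `L s` of regular loops with `L 0 = L₀`,
`d/ds H (L s) = ∫ trace (X · ∂L/∂s) dx` at `s = 0`. -/
def HasVarDeriv (T : ℝ) (H : (ℝ → Mat) → ℝ) (L₀ X : ℝ → Mat) : Prop :=
  X ∈ loopAlgebra T ∧
    ∀ L : ℝ → ℝ → Mat, (∀ i j, ContDiff ℝ ∞ fun p : ℝ × ℝ => L p.1 p.2 i j) →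
      (∀ s, L s ∈ regularLoops T) → L 0 = L₀ →
      HasDerivAt (fun s => H (L s))
        (∫ x in (0 : ℝ)..T, (X x * matDeriv (fun s => L s x) 0).trace) 0

/-- The Poisson bracket on the dual of the loop algebra, at `L`, of two functionals with
variational derivatives `X` and `Y`: `∫ trace ((Xₓ + [L, X]) Y) dx`. -/
def loopBracket (T : ℝ) (L X Y : ℝ → Mat) : ℝ :=
  ∫ x in (0 : ℝ)..T, ((matDeriv X x + (L x * X x - X x * L x)) * Y x).trace

/-! ## The geometric Poisson bracket on the space of invariants -/

/-- The space of invariants: smooth `T`-periodic `k = (k₀, k₁, k₂)` with `k₀ > 0`. -/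
def invariantSpace (T : ℝ) : Set (ℝ → Fin 3 → ℝ) :=
  {k | ContDiff ℝ ∞ k ∧ (∀ x, k (x + T) = k x) ∧ ∀ x, 0 < k x 0}

/-- `φ = (δh/δk₀, δh/δk₁, δh/δk₂)` is the variational derivative at `κ` of the functional `h` on
the space of invariants. -/
def HasVarDerivInv (T : ℝ) (h : (ℝ → Fin 3 → ℝ) → ℝ) (κ φ : ℝ → Fin 3 → ℝ) : Prop :=
  (ContDiff ℝ ∞ φ ∧ ∀ x, φ (x + T) = φ x) ∧
    ∀ k : ℝ → ℝ → Fin 3 → ℝ, ContDiff ℝ ∞ (fun p : ℝ × ℝ => k p.1 p.2) →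
      (∀ s, k s ∈ invariantSpace T) → k 0 = κ →
      HasDerivAt (fun s => h (k s))
        (∫ x in (0 : ℝ)..T, ∑ i, φ x i * deriv (fun s => k s x i) 0) 0

/-- Functionals on the space of invariants that have a variational derivative everywhere. -/
def IsFunctional (T : ℝ) (h : (ℝ → Fin 3 → ℝ) → ℝ) : Prop :=
  ∀ k ∈ invariantSpace T, ∃ φ, HasVarDerivInv T h k φ

/-- `H` is an extension of `h` to the regular loops that has a variational derivative everywhere
and is constant on the gauge leaves of the loops in the isotropy subgroup. -/
structure IsInvariantExtension (T : ℝ) (h : (ℝ → Fin 3 → ℝ) → ℝ) (H : (ℝ → Mat) → ℝ) :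
    Prop where
  varDeriv : ∀ L ∈ regularLoops T, ∃ X, HasVarDeriv T H L X
  extends_h : ∀ k ∈ invariantSpace T, H (fun x => mcMatrix (k x)) = h k
  gauge_inv : ∀ g ∈ loopIsotropy T, ∀ L ∈ regularLoops T, H (gauge g L) = H L

/-- The geometric Poisson bracket `{h, f}(k) = c`: the reduction of the bracket on loops, computed
from extensions of `h` and `f` that are constant on the gauge leaves. -/
def GeometricBracket (T : ℝ) (h f : (ℝ → Fin 3 → ℝ) → ℝ) (k : ℝ → Fin 3 → ℝ) (c : ℝ) : Prop :=
  ∃ H G : (ℝ → Mat) → ℝ, IsInvariantExtension T h H ∧ IsInvariantExtension T f G ∧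
    ∃ X Y : ℝ → Mat, HasVarDeriv T H (fun x => mcMatrix (k x)) X ∧
      HasVarDeriv T G (fun x => mcMatrix (k x)) Y ∧
      c = loopBracket T (fun x => mcMatrix (k x)) X Y

/-- `ξ` is the value at `k` of the Hamiltonian vector field of `h`:
`df(k)(ξ) = {h, f}(k)` for every functional `f`. -/
def IsHamiltonianVector (T : ℝ) (h : (ℝ → Fin 3 → ℝ) → ℝ) (k ξ : ℝ → Fin 3 → ℝ) : Prop :=
  (ContDiff ℝ ∞ ξ ∧ ∀ x, ξ (x + T) = ξ x) ∧
    ∀ f : (ℝ → Fin 3 → ℝ) → ℝ, IsFunctional T f → ∀ φ, HasVarDerivInv T f k φ →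
      GeometricBracket T h f k (∫ x in (0 : ℝ)..T, ∑ i, φ x i * ξ x i)

/-- At time `t` the invariants of the family `u` evolve by the Hamiltonian vector field of `h`. -/
def InvariantsHamiltonianAt (T : ℝ) (h : (ℝ → Fin 3 → ℝ) → ℝ) (u : ℝ → ℝ → Vec) (t : ℝ) :
    Prop :=
  ∃ ξ, IsHamiltonianVector T h (invariants (u t)) ξ ∧
    ∀ x i, HasDerivAt (fun s => invariants (u s) x i) (ξ x i) t

/-! ## Hamiltonian evolutions on the invariants and preservation of arc-length -/

/-- The evolution induces a Hamiltonian evolution on the invariants of all its solutions. -/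
def InducesHamiltonianEvolution {n : ℕ} (T : ℝ) (F : (Fin (n + 1) → Vec) → Vec) : Prop :=
  ∃ h, IsFunctional T h ∧ ∀ (I : Set ℝ) (u : ℝ → ℝ → Vec), IsSolution T F I u →
    ∀ t ∈ I, InvariantsHamiltonianAt T h u t

/-- The arc-length invariant of every solution is constant in time. -/
def PreservesArcLength {n : ℕ} (T : ℝ) (F : (Fin (n + 1) → Vec) → Vec) : Prop :=
  ∀ (I : Set ℝ) (u : ℝ → ℝ → Vec), IsSolution T F I u →
    ∀ s ∈ I, ∀ t ∈ I, ∀ x, arcLength (u s) x = arcLength (u t) x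

/-- The same at the level of vector fields, without reference to the solvability of the evolution
equation: the velocity of the invariants at a curve that moves with velocity `F` (at one time) is
the Hamiltonian vector field. -/
def InducesHamiltonianField {n : ℕ} (T : ℝ) (F : (Fin (n + 1) → Vec) → Vec) : Prop :=
  ∃ h, IsFunctional T h ∧ ∀ (I : Set ℝ) (u : ℝ → ℝ → Vec), IsFlow T I u →
    ∀ t ∈ I, EvolvesAt F u t → InvariantsHamiltonianAt T h u t

/-- The arc-length invariant of a curve that moves with velocity `F` has velocity zero. -/
def FieldPreservesArcLength {n : ℕ} (T : ℝ) (F : (Fin (n + 1) → Vec) → Vec) : Prop :=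
  ∀ (I : Set ℝ) (u : ℝ → ℝ → Vec), IsFlow T I u → ∀ t ∈ I, EvolvesAt F u t →
    ∀ x, HasDerivAt (fun s => arcLength (u s) x) 0 t

end LightCone

end

noncomputable section

namespace LightCone

/-! ## The invariants of a cone curve -/

/-! The theorem holds because every weighted length `f(k) = ∫ ψ k₀` is a Casimir of the geometric
bracket, so a Hamiltonian vector field cannot move `k₀`.

Let `𝔫` be the abelian Lie algebra of the unipotent radical of the isotropy group, and let `Y` be
the variational derivative at `K` of a gauge invariant extension of `f`. Since `f` does not see `k₁`
and `k₂`, the entries of `Y` dual to these directions vanish. Gauge invariance gives `∫ trace (Y (Zₓ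
+ [K, Z])) = 0` for every periodic loop `Z` in `𝔫`. A suitable `Z` built from entries of `Y` turns
this into the vanishing of `∫ k₀ (Y₀₀² + Y₂₁²)`, and `k₀ > 0` then forces `Y` into `𝔫`
(`varDeriv_eq_horo`).

For any `h`, with `X` the derivative of its extension, integration by parts gives `{h, f} = -∫ trace
(X (Yₓ + [K, Y]))`. As `Y` is itself an infinitesimal gauge parameter and `X` annihilates gauge
directions, this is zero (`geometricBracket_weightedLength`). Hence `∫ ψ ξ₀ = 0` for a Hamiltonian
vector `ξ`, and `ψ = ξ₀` yields `ξ₀ = 0`.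

Transfer to curves needs that the invariants of a cone curve are smooth and periodic and that the
first one is `‖u'‖` (`IsConeCurve.invariants_mem`, `IsConeCurve.invariants_zero`). -/

theorem mink_mulVec {m : Mat} (hm : m ∈ SO31) (p q : Vec) :
    mink (m.mulVec p) (m.mulVec q) = mink p q := by
  have h : m.transpose.mulVec (J.mulVec (m.mulVec q)) = J.mulVec q := by
    rw [Matrix.mulVec_mulVec, Matrix.mulVec_mulVec, hm.1]
  rw [mink, mink, ← h, Matrix.dotProduct_mulVec p, Matrix.vecMul_transpose]

theorem inv_eq_of_mem {m : Mat} (hm : m ∈ SO31) : m⁻¹ = J * m.transpose * J := by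
  apply Matrix.inv_eq_left_inv
  rw [Matrix.mul_assoc, Matrix.mul_assoc, ← Matrix.mul_assoc m.transpose, hm.1, J_mul_J]

theorem isUnit_det_of_mem {m : Mat} (hm : m ∈ SO31) : IsUnit m.det := by
  rw [hm.2]; exact isUnit_one

theorem mul_mem_SO31 {a b : Mat} (ha : a ∈ SO31) (hb : b ∈ SO31) : a * b ∈ SO31 := by
  refine ⟨?_, by rw [Matrix.det_mul, ha.2, hb.2, one_mul]⟩
  calc (a * b).transpose * J * (a * b) = b.transpose * (a.transpose * J * a) * b := by
        simp only [Matrix.transpose_mul, Matrix.mul_assoc]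
    _ = J := by rw [ha.1, hb.1]

theorem inv_mem_SO31 {m : Mat} (hm : m ∈ SO31) : m⁻¹ ∈ SO31 := by
  have h := Matrix.mul_nonsing_inv m (isUnit_det_of_mem hm)
  refine ⟨?_, by rw [Matrix.det_nonsing_inv, hm.2]; simp⟩
  calc m⁻¹.transpose * J * m⁻¹ = m⁻¹.transpose * (m.transpose * J * m) * m⁻¹ := by rw [hm.1]
    _ = (m * m⁻¹).transpose * J * (m * m⁻¹) := by
      simp only [Matrix.transpose_mul, Matrix.mul_assoc]
    _ = J := by rw [h]; simp

/-- The left frame is equivariant under the Lorentz group. -/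
theorem leftFrameJet_mulVec {m : Mat} (hm : m ∈ SO31) {p q r : Vec} (hp : mink p p = 0)
    (hpq : mink p q = 0) (hq : 0 < mink q q) (hpr : mink p r = -mink q q) :
    leftFrameJet (m.mulVec p) (m.mulVec q) (m.mulVec r) = m * leftFrameJet p q r := by
  have hA := leftFrameJet_mem hp hpq hq hpr
  have hB := leftFrameJet_mem (p := m.mulVec p) (q := m.mulVec q) (r := m.mulVec r)
    (by rwa [mink_mulVec hm]) (by rwa [mink_mulVec hm]) (by rwa [mink_mulVec hm])
    (by rwa [mink_mulVec hm, mink_mulVec hm])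
  obtain ⟨-, h3, h1, h2⟩ := (isNormalizedFrame_iff hp hpq hq hpr _).2 rfl
  have hc : ∀ v, ((leftFrameJet p q r)⁻¹ * m⁻¹).mulVec (m.mulVec v) =
      (leftFrameJet p q r)⁻¹.mulVec v := fun v => by
    rw [Matrix.mulVec_mulVec, Matrix.mul_assoc, Matrix.nonsing_inv_mul _ (isUnit_det_of_mem hm),
      Matrix.mul_one]
  -- By uniqueness of the normalized frame it suffices that `ρ m⁻¹`, with `ρ` the right frame at the
  -- original jet, satisfies the normalization at the transformed jet.
  have key := (isNormalizedFrame_iff (p := m.mulVec p) (q := m.mulVec q) (r := m.mulVec r)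
    (by rwa [mink_mulVec hm]) (by rwa [mink_mulVec hm]) (by rwa [mink_mulVec hm])
    (by rwa [mink_mulVec hm, mink_mulVec hm]) ((leftFrameJet p q r)⁻¹ * m⁻¹)).1
    ⟨mul_mem_SO31 (inv_mem_SO31 hA) (inv_mem_SO31 hm), by rw [hc, h3],
      by rw [hc, h1, mink_mulVec hm], by rw [hc, h2]⟩
  rw [← Matrix.mul_inv_rev] at key
  rw [← Matrix.nonsing_inv_nonsing_inv (leftFrameJet (m.mulVec p) _ _) (isUnit_det_of_mem hB),
    ← key, Matrix.nonsing_inv_nonsing_inv _ (isUnit_det_of_mem (mul_mem_SO31 hm hA))]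

/-! ### Smoothness of the frame vectors -/

theorem hasDerivAt_mink {a b : ℝ → Vec} {a' b' : Vec} {x : ℝ} (ha : HasDerivAt a a' x)
    (hb : HasDerivAt b b' x) :
    HasDerivAt (fun y => mink (a y) (b y)) (mink a' (b x) + mink (a x) b') x := by
  simp only [mink_apply]
  have ha' := hasDerivAt_pi.1 ha
  have hb' := hasDerivAt_pi.1 hb
  refine (((((ha' 1).mul (hb' 1)).add ((ha' 2).mul (hb' 2))).sub ((ha' 0).mul (hb' 3))).sub
    ((ha' 3).mul (hb' 0))).congr_deriv ?_
  ring

theorem contDiff_mink {a b : ℝ → Vec} (ha : ContDiff ℝ ∞ a) (hb : ContDiff ℝ ∞ b) :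
    ContDiff ℝ ∞ fun x => mink (a x) (b x) := by
  have ha' := contDiff_pi.1 ha
  have hb' := contDiff_pi.1 hb
  simp only [mink_apply]
  fun_prop

theorem contDiff_det_of_rows {a b c d : ℝ → Vec} (ha : ContDiff ℝ ∞ a) (hb : ContDiff ℝ ∞ b)
    (hc : ContDiff ℝ ∞ c) (hd : ContDiff ℝ ∞ d) :
    ContDiff ℝ ∞ fun x => (Matrix.of ![a x, b x, c x, d x]).det := by
  have ha' := contDiff_pi.1 ha
  have hb' := contDiff_pi.1 hb
  have hc' := contDiff_pi.1 hc
  have hd' := contDiff_pi.1 hd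
  simp only [det_of_rows]
  fun_prop

theorem contDiff_cross {a b c : ℝ → Vec} (ha : ContDiff ℝ ∞ a) (hb : ContDiff ℝ ∞ b)
    (hc : ContDiff ℝ ∞ c) : ContDiff ℝ ∞ fun x => cross (a x) (b x) (c x) := by
  refine contDiff_pi.2 fun i => ?_
  simp only [cross, Matrix.mulVec, dotProduct]
  exact ContDiff.sum fun j _ => contDiff_const.mul
    (contDiff_det_of_rows ha hb contDiff_const hc)

theorem contDiff_tangentVec {q : ℝ → Vec} (hq : ContDiff ℝ ∞ q) (h : ∀ x, 0 < mink (q x) (q x)) :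
    ContDiff ℝ ∞ fun x => tangentVec (q x) :=
  (((contDiff_mink hq hq).sqrt fun x => (h x).ne').inv
    fun x => (Real.sqrt_pos.2 (h x)).ne').smul hq

theorem contDiff_transVec {p q r : ℝ → Vec} (hp : ContDiff ℝ ∞ p) (hq : ContDiff ℝ ∞ q)
    (hr : ContDiff ℝ ∞ r) (h : ∀ x, 0 < mink (q x) (q x)) :
    ContDiff ℝ ∞ fun x => transVec (p x) (q x) (r x) := by
  have h0 : ∀ x, mink (q x) (q x) ≠ 0 := fun x => (h x).ne'
  have hqq := contDiff_mink hq hq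
  have hqr := contDiff_mink hq hr
  exact (hqq.inv h0).smul ((hr.sub ((hqr.div hqq h0).smul hq)).sub
    (((((hqr.pow 2).div hqq h0).sub (contDiff_mink hr hr)).div (contDiff_const.mul hqq)
      fun x => mul_ne_zero two_ne_zero (h0 x)).smul hp))

/-! ### Frame, monodromy and invariants along a cone curve -/

namespace IsConeCurve

variable {T : ℝ} {γ : ℝ → Vec}

theorem contDiff_deriv (h : IsConeCurve T γ) : ContDiff ℝ ∞ (deriv γ) :=
  ContDiff.iterate_deriv 1 h.smooth

theorem contDiff_iteratedDeriv (h : IsConeCurve T γ) : ContDiff ℝ ∞ (iteratedDeriv 2 γ) := by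
  rw [iteratedDeriv_eq_iterate]; exact ContDiff.iterate_deriv 2 h.smooth

theorem hasDerivAt (h : IsConeCurve T γ) (x : ℝ) : HasDerivAt γ (deriv γ x) x :=
  (h.smooth.differentiable (by simp) x).hasDerivAt

theorem hasDerivAt_deriv (h : IsConeCurve T γ) (x : ℝ) :
    HasDerivAt (deriv γ) (iteratedDeriv 2 γ x) x := by
  rw [iteratedDeriv_succ, iteratedDeriv_one]
  exact (h.contDiff_deriv.differentiable (by simp) x).hasDerivAt

theorem mink_deriv (h : IsConeCurve T γ) (x : ℝ) : mink (γ x) (deriv γ x) = 0 := by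
  have h1 := hasDerivAt_mink (h.hasDerivAt x) (h.hasDerivAt x)
  simp only [h.onCone] at h1
  have h2 := h1.unique (hasDerivAt_const x 0)
  rw [mink_comm (deriv γ x)] at h2
  linarith

theorem mink_iteratedDeriv (h : IsConeCurve T γ) (x : ℝ) :
    mink (γ x) (iteratedDeriv 2 γ x) = -mink (deriv γ x) (deriv γ x) := by
  have h1 := hasDerivAt_mink (h.hasDerivAt x) (h.hasDerivAt_deriv x)
  simp only [h.mink_deriv] at h1
  have h2 := h1.unique (hasDerivAt_const x 0)
  linarith

theorem leftFrame_mem (h : IsConeCurve T γ) (x : ℝ) : leftFrame γ x ∈ SO31 :=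
  leftFrameJet_mem (h.onCone x) (h.mink_deriv x) (h.starShaped x) (h.mink_iteratedDeriv x)

theorem contDiff_leftFrame (h : IsConeCurve T γ) (i j : Fin 4) :
    ContDiff ℝ ∞ fun x => leftFrame γ x i j := by
  have ht := contDiff_tangentVec h.contDiff_deriv h.starShaped
  have hv := contDiff_transVec h.smooth h.contDiff_deriv h.contDiff_iteratedDeriv h.starShaped
  have hc := contDiff_cross hv ht h.smooth
  simp only [leftFrame, leftFrameJet, Matrix.transpose_apply, Matrix.of_apply]
  fin_cases j
  · exact contDiff_pi.1 hv i
  · exact contDiff_pi.1 ht i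
  · exact contDiff_pi.1 hc i
  · exact contDiff_pi.1 h.smooth i

theorem contDiff_maurerCartan (h : IsConeCurve T γ) (i j : Fin 4) :
    ContDiff ℝ ∞ fun x => maurerCartan γ x i j := by
  have hL := h.contDiff_leftFrame
  have hD : ∀ i j, ContDiff ℝ ∞ (deriv fun y => leftFrame γ y i j) :=
    fun i j => ContDiff.iterate_deriv 1 (hL i j)
  simp only [maurerCartan, inv_eq_of_mem (h.leftFrame_mem _), Matrix.mul_apply, matDeriv,
    Matrix.of_apply, Matrix.transpose_apply]
  fun_prop

/-- The monodromy matrix is constant, so it carries the whole jet at `x` to the jet at `x + T`;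
equivariance of the frame does the rest. -/
theorem leftFrame_add (h : IsConeCurve T γ) : ∃ m ∈ SO31, ∀ x,
    leftFrame γ (x + T) = m * leftFrame γ x := by
  obtain ⟨m, hm, hγ⟩ := h.monodromy
  refine ⟨m, hm, fun x => ?_⟩
  have e : ∀ n : ℕ, iteratedDeriv n γ (x + T) = m.mulVec (iteratedDeriv n γ x) := fun n => by
    have h1 := congrFun (iteratedDeriv_comp_add_const n γ T) x
    have h2 : (fun y => γ (y + T)) = fun y => (Matrix.mulVecLin m).toContinuousLinearMap (γ y) :=
      funext fun y => by simp [hγ]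
    rw [← h1, h2]
    have h3 := (Matrix.mulVecLin m).toContinuousLinearMap.iteratedFDeriv_comp_left
      (f := γ) (x := x) (i := n) (n := ∞) h.smooth.contDiffAt (by exact_mod_cast le_top)
    rw [iteratedDeriv, iteratedDeriv]
    exact congrArg (fun F => F fun _ => 1) h3
  have e1 := e 1
  rw [iteratedDeriv_one] at e1
  rw [leftFrame, hγ, e1, e 2, leftFrameJet_mulVec hm (h.onCone x) (h.mink_deriv x)
    (h.starShaped x) (h.mink_iteratedDeriv x), leftFrame]

/-- The constant left factor `m` cancels in `λ⁻¹ λₓ`: the curve is periodic only up to `m`, but its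
invariants are truly periodic. -/
theorem maurerCartan_add (h : IsConeCurve T γ) (x : ℝ) :
    maurerCartan γ (x + T) = maurerCartan γ x := by
  obtain ⟨m, hm, hl⟩ := h.leftFrame_add
  have hd : matDeriv (leftFrame γ) (x + T) = m * matDeriv (leftFrame γ) x := by
    ext i j
    have h1 := (deriv_comp_add_const (f := fun y => leftFrame γ y i j) (a := T) (x := x)).symm
    simp only [matDeriv, Matrix.of_apply, Matrix.mul_apply]
    rw [h1]
    simp only [hl, Matrix.mul_apply]
    rw [deriv_fun_sum fun k _ => ((h.contDiff_leftFrame k j).differentiable (by simp) x).const_mul _]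
    exact Finset.sum_congr rfl fun k _ => deriv_const_mul _
      ((h.contDiff_leftFrame k j).differentiable (by simp) x)
  rw [maurerCartan, maurerCartan, hd, hl, Matrix.mul_inv_rev, Matrix.mul_assoc,
    ← Matrix.mul_assoc m⁻¹, Matrix.nonsing_inv_mul _ (isUnit_det_of_mem hm), Matrix.one_mul]

/-- The first invariant is the arc-length invariant. -/
theorem invariants_zero (h : IsConeCurve T γ) (x : ℝ) : invariants γ x 0 = arcLength γ x := by
  have ht := contDiff_tangentVec h.contDiff_deriv h.starShaped
  have ht' := (ht.differentiable (by simp) x).hasDerivAt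
  -- With `τ` the unit tangent, differentiating `⟨γ, τ⟩ = 0` gives `-⟨γ, τ'⟩ = ⟨γ', τ⟩ = ‖γ'‖`.
  -- Because `λ⁻¹ = J λᵀ J`, the left side is the `(0, 1)` entry of `λ⁻¹ λₓ`.
  have h0 : ∀ y, mink (γ y) (tangentVec (deriv γ y)) = 0 := fun y => by
    rw [tangentVec, mink_smul, h.mink_deriv, mul_zero]
  have h1 := hasDerivAt_mink (h.hasDerivAt x) ht'
  simp only [h0] at h1
  have h2 := h1.unique (hasDerivAt_const x 0)
  have h3 : mink (deriv γ x) (tangentVec (deriv γ x)) = arcLength γ x := by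
    have hs := Real.sqrt_pos.2 (h.starShaped x)
    rw [tangentVec, mink_smul, arcLength, inv_mul_eq_div, div_eq_iff hs.ne',
      Real.mul_self_sqrt (h.starShaped x).le]
  have hd : ∀ i, deriv (fun y => leftFrame γ y i 1) x =
      deriv (fun y => tangentVec (deriv γ y)) x i := fun i => by
    rw [← (hasDerivAt_pi.1 ht' i).deriv]; rfl
  have h4 : invariants γ x 0 = -mink (γ x) (deriv (fun y => tangentVec (deriv γ y)) x) := by
    have hc : ∀ i, leftFrame γ x i 3 = γ x i := fun i => rfl
    simp only [invariants, maurerCartan, inv_eq_of_mem (h.leftFrame_mem _), Matrix.mul_apply,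
      matDeriv, Matrix.of_apply, Matrix.transpose_apply, mink_apply, Matrix.cons_val_zero,
      Fin.sum_univ_four, hd, J]
    simp [hc]
    ring
  linarith

theorem invariants_mem (h : IsConeCurve T γ) : invariants γ ∈ invariantSpace T := by
  refine ⟨contDiff_pi.2 fun i => ?_, fun x => ?_, fun x => ?_⟩
  · fin_cases i <;> exact h.contDiff_maurerCartan _ _
  · simp only [invariants, h.maurerCartan_add]
  · rw [h.invariants_zero]
    exact Real.sqrt_pos.2 (h.starShaped x)

end IsConeCurve

/-! ## Integrals over a period -/

theorem eq_zero_of_integral_eq_zero {T : ℝ} (hT : 0 < T) {f : ℝ → ℝ} (hf : Continuous f)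
    (h0 : ∀ x, 0 ≤ f x) (hp : ∀ x, f (x + T) = f x) (hi : ∫ x in (0 : ℝ)..T, f x = 0) (x : ℝ) :
    f x = 0 := by
  by_contra hx
  have h1 := Function.Periodic.intervalIntegral_add_eq (f := f) (T := T) hp x 0
  -- By periodicity the window may start at `x`, so it contains the point where `f` would be
  -- positive.
  rw [zero_add, hi] at h1
  have h2 := intervalIntegral.integral_pos (a := x) (b := x + T) (by linarith) hf.continuousOn
    (fun y _ => h0 y) ⟨x, ⟨le_rfl, by linarith⟩, (h0 x).lt_of_ne' hx⟩
  exact h2.ne' h1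

theorem integral_deriv_eq_zero {T : ℝ} {f : ℝ → ℝ} (hf : ContDiff ℝ ∞ f)
    (hp : ∀ x, f (x + T) = f x) : ∫ x in (0 : ℝ)..T, deriv f x = 0 := by
  rw [intervalIntegral.integral_deriv_eq_sub (fun x _ => hf.differentiable (by simp) x)
    ((ContDiff.iterate_deriv 1 hf).continuous.intervalIntegrable _ _)]
  have := hp 0
  rw [zero_add] at this
  rw [this, sub_self]

theorem hasDerivAt_integral_of_contDiff {f : ℝ → ℝ → ℝ} {a b : ℝ}
    (hf : ContDiff ℝ ∞ fun p : ℝ × ℝ => f p.1 p.2) :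
    HasDerivAt (fun s => ∫ x in a..b, f s x) (∫ x in a..b, deriv (fun s => f s x) 0) 0 := by
  set f' : ℝ × ℝ → ℝ := fun p => fderiv ℝ (fun p : ℝ × ℝ => f p.1 p.2) p (1, 0) with hf'
  have hc : Continuous f' :=
    (hf.continuous_fderiv (by simp)).clm_apply continuous_const
  have hd : ∀ s x, HasDerivAt (fun s => f s x) (f' (s, x)) s := fun s x => by
    have h1 := (hf.differentiable (by simp) (s, x)).hasFDerivAt
    have h2 : HasDerivAt (fun s : ℝ => (s, x)) (1, 0) s :=
      (hasDerivAt_id s).prodMk (hasDerivAt_const s x)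
    exact h1.comp_hasDerivAt s h2
  have hx : ∀ s, Continuous (f s) := fun s =>
    hf.continuous.comp (continuous_const.prodMk continuous_id)
  have hx' : ∀ s, Continuous fun x => f' (s, x) := fun s =>
    hc.comp (continuous_const.prodMk continuous_id)
  -- Only the derivative at `s = 0` matters, so a bound on a compact window around it dominates.
  obtain ⟨C, hC⟩ := ((isCompact_Icc (a := (-1 : ℝ)) (b := 1)).prod
    (isCompact_uIcc (a := a) (b := b))).exists_bound_of_continuousOn hc.continuousOn
  simp only [(hd _ _).deriv]
  refine (intervalIntegral.hasDerivAt_integral_of_dominated_loc_of_deriv_le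
    (F' := fun s x => f' (s, x)) (bound := fun _ => C)
    (Icc_mem_nhds (by norm_num : (-1 : ℝ) < 0) (by norm_num : (0 : ℝ) < 1))
    (Filter.Eventually.of_forall fun s => (hx s).aestronglyMeasurable)
    ((hx 0).intervalIntegrable _ _) (hx' 0).aestronglyMeasurable
    (Filter.Eventually.of_forall fun x hx s hs =>
      hC (s, x) ⟨hs, Set.uIoc_subset_uIcc hx⟩)
    intervalIntegrable_const
    (Filter.Eventually.of_forall fun x _ s _ => hd s x)).2

theorem deriv_add_of_periodic {T : ℝ} {f : ℝ → ℝ} (hp : ∀ x, f (x + T) = f x) (x : ℝ) :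
    deriv f (x + T) = deriv f x := by
  rw [← deriv_comp_add_const]; simp only [hp]

/-! ## Weighted arc-length functionals -/

/-- The functional `k ↦ ∫ ψ k₀ dx`. -/
def weightedLength (T : ℝ) (ψ : ℝ → ℝ) (k : ℝ → Fin 3 → ℝ) : ℝ :=
  ∫ x in (0 : ℝ)..T, ψ x * k x 0

/-- The functional is linear in `k₀`, so its derivative is the same at every `κ`. These are the test
functionals that isolate the `k₀` component of a Hamiltonian vector. -/
theorem hasVarDerivInv_weightedLength {T : ℝ} {ψ : ℝ → ℝ} (hψ : ContDiff ℝ ∞ ψ)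
    (hp : ∀ x, ψ (x + T) = ψ x) (κ : ℝ → Fin 3 → ℝ) :
    HasVarDerivInv T (weightedLength T ψ) κ fun x => ![ψ x, 0, 0] := by
  refine ⟨⟨contDiff_pi.2 fun i => ?_, fun x => by simp only [hp]⟩, fun k hk _ _ => ?_⟩
  · fin_cases i
    · exact hψ
    · exact contDiff_const
    · exact contDiff_const
  · have hk0 := contDiff_pi.1 hk 0
    have h1 := hasDerivAt_integral_of_contDiff (f := fun s x => ψ x * k s x 0) (a := 0) (b := T)
      ((hψ.comp contDiff_snd).mul hk0)
    refine h1.congr_deriv (intervalIntegral.integral_congr fun x _ => ?_)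
    simp only [Fin.sum_univ_three, Matrix.cons_val_zero, Matrix.cons_val_one, Matrix.cons_val,
      zero_mul, add_zero]
    have h2 : ContDiff ℝ ∞ fun s => k s x 0 := hk0.comp (contDiff_id.prodMk contDiff_const)
    exact deriv_const_mul _ (h2.differentiable (by simp) 0)

theorem isFunctional_weightedLength {T : ℝ} {ψ : ℝ → ℝ} (hψ : ContDiff ℝ ∞ ψ)
    (hp : ∀ x, ψ (x + T) = ψ x) : IsFunctional T (weightedLength T ψ) :=
  fun κ _ => ⟨_, hasVarDerivInv_weightedLength hψ hp κ⟩

/-! ## The unipotent part of the gauge action -/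

/-- The matrices of the unipotent radical of the isotropy subgroup. -/
def horo (a b : ℝ) : Mat :=
  !![1, 0, 0, 0; a, 1, 0, 0; b, 0, 1, 0; (a ^ 2 + b ^ 2) / 2, a, b, 1]

/-- `horo a b` is the exponential of an element of an abelian algebra depending linearly on `(a,
b)`, so negating the parameters inverts it. -/
theorem horo_mul_neg (a b : ℝ) : horo (-a) (-b) * horo a b = 1 := by
  ext i j
  fin_cases i <;> fin_cases j <;> simp [horo]
  ring

theorem horo_mem_isotropy (a b : ℝ) : horo a b ∈ isotropy := by
  refine ⟨⟨?_, ?_⟩, ?_⟩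
  · ext i j
    fin_cases i <;> fin_cases j <;> simp [horo, J, Matrix.mul_apply, Fin.sum_univ_four]
    all_goals ring
  · rw [horo, det_of_rows]; simp
  · ext i
    fin_cases i <;> simp [horo, Matrix.mulVec, dotProduct, Fin.sum_univ_four]

/-- The gauge transform of the Maurer-Cartan matrix `mcMatrix k` by `horo (s a) (s b)`, where
`a'` and `b'` stand for the derivatives of `a` and `b`. -/
def horoGauge (k : Fin 3 → ℝ) (a b a' b' s : ℝ) : Mat :=
  !![s * (k 0 * a), k 0, 0, 0;
    k 1 + s * a' + s ^ 2 * (k 0 * (b ^ 2 - a ^ 2) / 2), 0, s * (k 0 * b), k 0;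
    k 2 + s * b' - s ^ 2 * (k 0 * a * b), -(s * (k 0 * b)), 0, 0;
    0, k 1 + s * a' + s ^ 2 * (k 0 * (b ^ 2 - a ^ 2) / 2),
      k 2 + s * b' - s ^ 2 * (k 0 * a * b), -(s * (k 0 * a))]

/-- The infinitesimal gauge transformation `Zₓ + [mcMatrix k, Z]` for `Z` in the Lie algebra
of the unipotent radical of the isotropy subgroup. -/
def horoVelocity (k : Fin 3 → ℝ) (a b a' b' : ℝ) : Mat :=
  !![k 0 * a, 0, 0, 0; a', 0, k 0 * b, 0; b', -(k 0 * b), 0, 0; 0, a', b', -(k 0 * a)]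

/-- Variational derivatives are tested on actual families of regular loops, so the full orbit is
needed and not only its tangent. It is explicit since it is quadratic in `s`. -/
theorem gauge_horo (k : ℝ → Fin 3 → ℝ) {a b : ℝ → ℝ} (ha : ContDiff ℝ ∞ a)
    (hb : ContDiff ℝ ∞ b) (s : ℝ) :
    gauge (fun x => horo (s * a x) (s * b x)) (fun x => mcMatrix (k x)) =
      fun x => horoGauge (k x) (a x) (b x) (deriv a x) (deriv b x) s := by
  funext x
  have ha' := (ha.differentiable (by simp) x).hasDerivAt
  have hb' := (hb.differentiable (by simp) x).hasDerivAt
  have hq : deriv (fun y => ((s * a y) ^ 2 + (s * b y) ^ 2) / 2) x =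
      s ^ 2 * (a x * deriv a x + b x * deriv b x) := by
    have h := ((((ha'.const_mul s).pow 2).add ((hb'.const_mul s).pow 2)).div_const 2).deriv
    refine Eq.trans h ?_
    push_cast
    ring
  have hd : matDeriv (fun x => horo (s * a x) (s * b x)) x =
      !![0, 0, 0, 0; s * deriv a x, 0, 0, 0; s * deriv b x, 0, 0, 0;
        s ^ 2 * (a x * deriv a x + b x * deriv b x), s * deriv a x, s * deriv b x, 0] := by
    ext i j
    fin_cases i <;> fin_cases j <;>
      simp [matDeriv, horo, hq, (ha'.const_mul s).deriv, (hb'.const_mul s).deriv]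
  rw [gauge, hd, Matrix.inv_eq_left_inv (horo_mul_neg _ _)]
  ext i j
  fin_cases i <;> fin_cases j <;>
    simp [horo, mcMatrix, horoGauge] <;> ring

theorem matDeriv_horoGauge (k : Fin 3 → ℝ) (a b a' b' : ℝ) :
    matDeriv (fun s => horoGauge k a b a' b' s) 0 = horoVelocity k a b a' b' := by
  have h1 : ∀ c : ℝ, HasDerivAt (fun s => s * c) c 0 := fun c => by
    simpa using (hasDerivAt_id (0 : ℝ)).mul_const c
  have h2 : ∀ c : ℝ, HasDerivAt (fun s : ℝ => s ^ 2 * c) 0 0 := fun c => by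
    simpa using ((hasDerivAt_id (0 : ℝ)).pow 2).mul_const c
  have h3 : ∀ c d e : ℝ, deriv (fun s : ℝ => c + s * d + s ^ 2 * e) 0 = d := fun c d e => by
    exact (((h1 d).const_add c).add (h2 e)).deriv.trans (add_zero d)
  have h4 : ∀ c d e : ℝ, deriv (fun s : ℝ => c + s * d - s ^ 2 * e) 0 = d := fun c d e => by
    exact (((h1 d).const_add c).sub (h2 e)).deriv.trans (sub_zero d)
  ext i j
  fin_cases i <;> fin_cases j <;>
    simp [matDeriv, horoGauge, horoVelocity, h3, h4, (h1 _).deriv]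

/-- The last column is `(0, k₀, 0, -s k₀ a)`, whose Minkowski square is `k₀² > 0` for every `s`, so
the orbit never leaves the regular loops. -/
theorem horoGauge_mem_regularLoops {T : ℝ} {k : ℝ → Fin 3 → ℝ} (hk : k ∈ invariantSpace T)
    {a b : ℝ → ℝ} (ha : ContDiff ℝ ∞ a) (hb : ContDiff ℝ ∞ b) (hpa : ∀ x, a (x + T) = a x)
    (hpb : ∀ x, b (x + T) = b x) (s : ℝ) :
    (fun x => horoGauge (k x) (a x) (b x) (deriv a x) (deriv b x) s) ∈ regularLoops T := by
  have hk' := contDiff_pi.1 hk.1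
  have ha' : ContDiff ℝ ∞ (deriv a) := ContDiff.iterate_deriv 1 ha
  have hb' : ContDiff ℝ ∞ (deriv b) := ContDiff.iterate_deriv 1 hb
  refine ⟨⟨⟨fun i j => ?_, fun x => ?_⟩, fun x => ?_⟩, fun x => ?_⟩
  · fin_cases i <;> fin_cases j <;> simp [horoGauge] <;> fun_prop
  · simp only [hk.2.1, hpa, hpb, deriv_add_of_periodic hpa, deriv_add_of_periodic hpb]
  · change _ = _
    ext i j
    fin_cases i <;> fin_cases j <;>
      simp [horoGauge, J, Matrix.mul_apply, Fin.sum_univ_four]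
    ring
  · have := hk.2.2 x
    simp [mink_apply, horoGauge]
    positivity

theorem contDiff_horoGauge {k : ℝ → Fin 3 → ℝ} (hk : ContDiff ℝ ∞ k)
    {a b : ℝ → ℝ} (ha : ContDiff ℝ ∞ a) (hb : ContDiff ℝ ∞ b) (i j : Fin 4) :
    ContDiff ℝ ∞ fun p : ℝ × ℝ =>
      horoGauge (k p.2) (a p.2) (b p.2) (deriv a p.2) (deriv b p.2) p.1 i j := by
  have hk' : ∀ i, ContDiff ℝ ∞ fun p : ℝ × ℝ => k p.2 i :=
    fun i => (contDiff_pi.1 hk i).comp contDiff_snd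
  have ha0 : ContDiff ℝ ∞ fun p : ℝ × ℝ => a p.2 := ha.comp contDiff_snd
  have hb0 : ContDiff ℝ ∞ fun p : ℝ × ℝ => b p.2 := hb.comp contDiff_snd
  have ha' : ContDiff ℝ ∞ fun p : ℝ × ℝ => deriv a p.2 :=
    (ContDiff.iterate_deriv 1 ha).comp contDiff_snd
  have hb' : ContDiff ℝ ∞ fun p : ℝ × ℝ => deriv b p.2 :=
    (ContDiff.iterate_deriv 1 hb).comp contDiff_snd
  fin_cases i <;> fin_cases j <;> simp [horoGauge] <;> fun_prop

theorem horoGauge_zero (k : Fin 3 → ℝ) (a b a' b' : ℝ) :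
    horoGauge k a b a' b' 0 = mcMatrix k := by
  simp [horoGauge, mcMatrix]

theorem mcMatrix_mem_regularLoops {T : ℝ} {k : ℝ → Fin 3 → ℝ} (hk : k ∈ invariantSpace T) :
    (fun x => mcMatrix (k x)) ∈ regularLoops T := by
  have h := horoGauge_mem_regularLoops hk (a := fun _ => 0) (b := fun _ => 0) contDiff_const
    contDiff_const (fun _ => rfl) (fun _ => rfl) 0
  simpa only [horoGauge_zero] using h

/-- The variational derivative of an invariant extension annihilates the infinitesimal gauge
transformations. -/
theorem integral_trace_horoVelocity {T : ℝ} {h : (ℝ → Fin 3 → ℝ) → ℝ} {H : (ℝ → Mat) → ℝ}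
    (hH : IsInvariantExtension T h H) {k : ℝ → Fin 3 → ℝ} (hk : k ∈ invariantSpace T)
    {X : ℝ → Mat} (hX : HasVarDeriv T H (fun x => mcMatrix (k x)) X)
    {a b : ℝ → ℝ} (ha : ContDiff ℝ ∞ a) (hb : ContDiff ℝ ∞ b) (hpa : ∀ x, a (x + T) = a x)
    (hpb : ∀ x, b (x + T) = b x) :
    ∫ x in (0 : ℝ)..T,
      (X x * horoVelocity (k x) (a x) (b x) (deriv a x) (deriv b x)).trace = 0 := by
  have h1 := hX.2 (fun s x => horoGauge (k x) (a x) (b x) (deriv a x) (deriv b x) s)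
    (contDiff_horoGauge hk.1 ha hb) (horoGauge_mem_regularLoops hk ha hb hpa hpb)
    (by simp only [horoGauge_zero])
  have h2 : ∀ s, H (fun x => horoGauge (k x) (a x) (b x) (deriv a x) (deriv b x) s) =
      H fun x => mcMatrix (k x) := fun s => by
    rw [← gauge_horo k ha hb]
    refine hH.gauge_inv _ ⟨⟨fun i j => ?_, fun x => by simp only [hpa, hpb]⟩,
      fun x => horo_mem_isotropy _ _⟩ _ (mcMatrix_mem_regularLoops hk)
    fin_cases i <;> fin_cases j <;> simp [horo] <;> fun_prop
  simp only [h2, matDeriv_horoGauge] at h1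
  exact h1.unique (hasDerivAt_const _ _)

/-! ## The arc-length component of Hamiltonian vector fields -/

/-- Leaves six free coordinates: the entries `00`, `01`, `02`, `10`, `20`, `21`. -/
theorem so31_entries {X : Mat} (hX : X ∈ so31) :
    X 3 0 = 0 ∧ X 0 3 = 0 ∧ X 1 1 = 0 ∧ X 2 2 = 0 ∧ X 1 3 = X 0 1 ∧ X 2 3 = X 0 2 ∧
      X 3 1 = X 1 0 ∧ X 3 2 = X 2 0 ∧ X 3 3 = -X 0 0 ∧ X 1 2 = -X 2 1 := by
  have key : ∀ i j, (X.transpose * J + J * X) i j = 0 := fun i j => by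
    rw [show X.transpose * J + J * X = 0 from hX]; rfl
  have h00 := key 0 0
  have h33 := key 3 3
  have h11 := key 1 1
  have h22 := key 2 2
  have h01 := key 0 1
  have h02 := key 0 2
  have h31 := key 3 1
  have h32 := key 3 2
  have h03 := key 0 3
  have h12 := key 1 2
  simp [J, Matrix.mul_apply, Matrix.vecMul, dotProduct, Fin.sum_univ_four] at h00 h33 h11 h22 h01 h02 h31 h32 h03 h12
  refine ⟨?_, ?_, ?_, ?_, ?_, ?_, ?_, ?_, ?_, ?_⟩ <;> linarith

/-- The entries `10` and `20` of `X` drop out: they parametrize its component in the unipotent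
radical, which gauge invariance under that radical leaves unconstrained. -/
theorem trace_mul_horoVelocity {X : Mat} (hX : X ∈ so31) (k : Fin 3 → ℝ) (a b a' b' : ℝ) :
    (X * horoVelocity k a b a' b').trace =
      2 * (X 0 0 * (k 0 * a) + X 0 1 * a' + X 0 2 * b' + X 2 1 * (k 0 * b)) := by
  obtain ⟨h1, h2, h3, h4, h5, h6, h7, h8, h9, h10⟩ := so31_entries hX
  simp [Matrix.trace, Matrix.mul_apply, Fin.sum_univ_four, horoVelocity, h5, h6, h9, h10]
  ring

theorem trace_mul_mcVariation {X : Mat} (hX : X ∈ so31) (a b : ℝ) :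
    (X * !![0, 0, 0, 0; a, 0, 0, 0; b, 0, 0, 0; 0, a, b, 0]).trace =
      2 * (X 0 1 * a + X 0 2 * b) := by
  obtain ⟨h1, h2, h3, h4, h5, h6, h7, h8, h9, h10⟩ := so31_entries hX
  simp [Matrix.trace, Matrix.mul_apply, Fin.sum_univ_four, h5, h6]
  ring

/-- The variational derivative of an extension of a functional of `k₀` alone has no components
along `k₁` and `k₂`. -/
theorem varDeriv_entries_eq_zero_of_extends {T : ℝ} (hT : 0 < T) {ψ : ℝ → ℝ}
    {G : (ℝ → Mat) → ℝ} (hG : IsInvariantExtension T (weightedLength T ψ) G)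
    {k : ℝ → Fin 3 → ℝ} (hk : k ∈ invariantSpace T) {Y : ℝ → Mat}
    (hY : HasVarDeriv T G (fun x => mcMatrix (k x)) Y) (x : ℝ) : Y x 0 1 = 0 ∧ Y x 0 2 = 0 := by
  have hYs := hY.1.1.1
  -- Moving `k₁, k₂` in the direction of the entries of `Y` themselves leaves `∫ ψ k₀` fixed, while
  -- its first variation is `∫ 2 (Y₀₁² + Y₀₂²)`.
  set K : ℝ → ℝ → Fin 3 → ℝ := fun s x =>
    ![k x 0, k x 1 + s * Y x 0 1, k x 2 + s * Y x 0 2] with hK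
  have hk' := contDiff_pi.1 hk.1
  have hKm : ∀ s, K s ∈ invariantSpace T := fun s => by
    refine ⟨contDiff_pi.2 fun i => ?_, fun x => ?_, fun x => hk.2.2 x⟩
    · fin_cases i <;> simp [hK] <;> fun_prop
    · simp only [hK, hk.2.1, hY.1.1.2]
  have hd : ∀ c d : ℝ, deriv (fun s : ℝ => c + s * d) 0 = d := fun c d => by
    simp
  have h1 := hY.2 (fun s x => mcMatrix (K s x)) (fun i j => ?_)
    (fun s => mcMatrix_mem_regularLoops (hKm s)) ?_
  · have h2 : ∀ s, G (fun x => mcMatrix (K s x)) = weightedLength T ψ k := fun s => by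
      rw [hG.extends_h _ (hKm s)]; rfl
    have h3 : ∀ x, matDeriv (fun s => mcMatrix (K s x)) 0 =
        !![0, 0, 0, 0; Y x 0 1, 0, 0, 0; Y x 0 2, 0, 0, 0; 0, Y x 0 1, Y x 0 2, 0] := fun x => by
      ext i j
      fin_cases i <;> fin_cases j <;> simp [matDeriv, mcMatrix, hK]
    simp only [h2, h3, trace_mul_mcVariation (hY.1.2 _)] at h1
    have h4 := eq_zero_of_integral_eq_zero hT
      (f := fun x => 2 * (Y x 0 1 * Y x 0 1 + Y x 0 2 * Y x 0 2))
      (ContDiff.continuous (𝕜 := ℝ) (n := ∞) (by fun_prop)) (fun x => by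
        nlinarith [mul_self_nonneg (Y x 0 1), mul_self_nonneg (Y x 0 2)])
      (fun x => by simp only [hY.1.1.2]) (h1.unique (hasDerivAt_const _ _)) x
    constructor <;> nlinarith [mul_self_nonneg (Y x 0 1), mul_self_nonneg (Y x 0 2)]
  · have hk2 : ∀ i, ContDiff ℝ ∞ fun p : ℝ × ℝ => k p.2 i := fun i => (hk' i).comp contDiff_snd
    have hY2 : ∀ i j, ContDiff ℝ ∞ fun p : ℝ × ℝ => Y p.2 i j :=
      fun i j => (hYs i j).comp contDiff_snd
    fin_cases i <;> fin_cases j <;> simp [mcMatrix, hK] <;> fun_prop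
  · funext x
    simp [mcMatrix, hK]

/-- The variational derivative of an invariant extension of a functional of `k₀` alone lies in the
Lie algebra of the unipotent radical of the isotropy subgroup. -/
theorem varDeriv_eq_horo {T : ℝ} (hT : 0 < T) {ψ : ℝ → ℝ}
    {G : (ℝ → Mat) → ℝ} (hG : IsInvariantExtension T (weightedLength T ψ) G)
    {k : ℝ → Fin 3 → ℝ} (hk : k ∈ invariantSpace T) {Y : ℝ → Mat}
    (hY : HasVarDeriv T G (fun x => mcMatrix (k x)) Y) (x : ℝ) :
    Y x = !![0, 0, 0, 0; Y x 1 0, 0, 0, 0; Y x 2 0, 0, 0, 0; 0, Y x 1 0, Y x 2 0, 0] := by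
  have hYs := hY.1.1.1
  have hYp := hY.1.1.2
  have hk' := contDiff_pi.1 hk.1
  have h0 := fun x => varDeriv_entries_eq_zero_of_extends hT hG hk hY x
  -- The choice `a = Y₀₀`, `b = Y₂₁` makes the integrand `2 k₀ (Y₀₀² + Y₂₁²)`, the derivative terms
  -- having vanishing coefficients `Y₀₁`, `Y₀₂`.
  have h1 := integral_trace_horoVelocity hG hk hY (hYs 0 0) (hYs 2 1)
    (fun x => by rw [hYp]) (fun x => by rw [hYp])
  simp only [trace_mul_horoVelocity (hY.1.2 _), (h0 _).1, (h0 _).2, zero_mul, add_zero] at h1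
  have h2 := eq_zero_of_integral_eq_zero hT
    (f := fun x => 2 * (Y x 0 0 * (k x 0 * Y x 0 0) + Y x 2 1 * (k x 0 * Y x 2 1)))
    (ContDiff.continuous (𝕜 := ℝ) (n := ∞) (by fun_prop)) (fun x => by
      have := hk.2.2 x
      nlinarith [mul_nonneg this.le (mul_self_nonneg (Y x 0 0)),
        mul_nonneg this.le (mul_self_nonneg (Y x 2 1))])
    (fun x => by simp only [hYp, hk.2.1]) h1 x
  have hk0 := hk.2.2 x
  have e1 := mul_nonneg hk0.le (mul_self_nonneg (Y x 0 0))
  have e2 := mul_nonneg hk0.le (mul_self_nonneg (Y x 2 1))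
  have h00 : Y x 0 0 = 0 := by
    have : k x 0 * (Y x 0 0 * Y x 0 0) = 0 := by linarith
    simpa [hk0.ne'] using this
  have h21 : Y x 2 1 = 0 := by
    have : k x 0 * (Y x 2 1 * Y x 2 1) = 0 := by linarith
    simpa [hk0.ne'] using this
  obtain ⟨g1, g2, g3, g4, g5, g6, g7, g8, g9, g10⟩ := so31_entries (hY.1.2 x)
  ext i j
  fin_cases i <;> fin_cases j <;> simp [g1, g2, g3, g4, g5, g6, g7, g8, g9, g10, h00, h21, h0]

/-- Functionals of `k₀` alone are Casimirs of the geometric Poisson bracket. -/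
theorem geometricBracket_weightedLength {T : ℝ} (hT : 0 < T) {ψ : ℝ → ℝ}
    {h : (ℝ → Fin 3 → ℝ) → ℝ} {k : ℝ → Fin 3 → ℝ} (hk : k ∈ invariantSpace T) {c : ℝ}
    (hc : GeometricBracket T h (weightedLength T ψ) k c) : c = 0 := by
  -- The extensions are arbitrary; independence of the bracket from their choice plays no role.
  obtain ⟨H, G, hH, hG, X, Y, hX, hY, rfl⟩ := hc
  have hYe := varDeriv_eq_horo hT hG hk hY
  have hYs := hY.1.1.1
  have hYp := hY.1.1.2
  have hXs := hX.1.1.1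
  have hXp := hX.1.1.2
  have hk' := contDiff_pi.1 hk.1
  set a : ℝ → ℝ := fun x => Y x 1 0 with ha
  set b : ℝ → ℝ := fun x => Y x 2 0 with hb
  have has : ContDiff ℝ ∞ a := hYs 1 0
  have hbs : ContDiff ℝ ∞ b := hYs 2 0
  have hads : ContDiff ℝ ∞ (deriv a) := ContDiff.iterate_deriv 1 has
  have hbds : ContDiff ℝ ∞ (deriv b) := ContDiff.iterate_deriv 1 hbs
  -- `Y` lies in the unipotent algebra, so `Z = Y` is an admissible gauge direction for `X`.
  have h1 := integral_trace_horoVelocity hH hk hX has hbs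
    (fun x => by simp only [ha, hYp]) (fun x => by simp only [hb, hYp])
  simp only [trace_mul_horoVelocity (hX.1.2 _)] at h1
  have hfs : ContDiff ℝ ∞ fun x => 2 * (X x 0 1 * a x + X x 0 2 * b x) := by fun_prop
  have h2 := integral_deriv_eq_zero (T := T) hfs fun x => by simp only [ha, hb, hXp, hYp]
  -- Pointwise integration by parts: `trace ((Xₓ + [K, X]) Y)` equals `(trace (X Y))ₓ - trace (X (Yₓ
  -- + [K, Y]))`, where `trace (X Y) = 2 (X₀₁ a + X₀₂ b)`.
  have h3 : ∀ x, ((matDeriv X x + (mcMatrix (k x) * X x - X x * mcMatrix (k x))) * Y x).trace =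
      deriv (fun x => 2 * (X x 0 1 * a x + X x 0 2 * b x)) x -
        2 * (X x 0 0 * (k x 0 * a x) + X x 0 1 * deriv a x + X x 0 2 * deriv b x +
          X x 2 1 * (k x 0 * b x)) := fun x => by
    have hd : ∀ {f : ℝ → ℝ}, ContDiff ℝ ∞ f → HasDerivAt f (deriv f x) x :=
      fun hf => (hf.differentiable (by simp) x).hasDerivAt
    have h4 := ((((hd (hXs 0 1)).mul (hd has)).add
      ((hd (hXs 0 2)).mul (hd hbs))).const_mul 2).deriv
    refine Eq.trans ?_ (congrArg (· - _) h4.symm)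
    obtain ⟨g1, g2, g3, g4, g5, g6, g7, g8, g9, g10⟩ := so31_entries (hX.1.2 x)
    have d5 : deriv (fun y => X y 1 3) x = deriv (fun y => X y 0 1) x := by
      congr 1; funext y; exact (so31_entries (hX.1.2 y)).2.2.2.2.1
    have d6 : deriv (fun y => X y 2 3) x = deriv (fun y => X y 0 2) x := by
      congr 1; funext y; exact (so31_entries (hX.1.2 y)).2.2.2.2.2.1
    rw [hYe x]
    simp [Matrix.trace, Matrix.mul_apply, Matrix.vecMul, dotProduct, Fin.sum_univ_four, mcMatrix,
      matDeriv, ha, hb,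
      g1, g2, g3, g4, g5, g6, g7, g8, g9, g10, d5, d6]
    ring
  simp only [loopBracket, h3]
  rw [intervalIntegral.integral_sub, h1, h2, sub_zero]
  · exact (ContDiff.iterate_deriv 1 hfs).continuous.intervalIntegrable _ _
  · exact (ContDiff.continuous (𝕜 := ℝ) (n := ∞) (by fun_prop)).intervalIntegrable _ _

/-- Hamiltonian vector fields of the geometric bracket have no component along `k₀`. -/
theorem IsHamiltonianVector.zero_component {T : ℝ} (hT : 0 < T) {h : (ℝ → Fin 3 → ℝ) → ℝ}
    {k ξ : ℝ → Fin 3 → ℝ} (hk : k ∈ invariantSpace T) (hξ : IsHamiltonianVector T h k ξ) (x : ℝ) :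
    ξ x 0 = 0 := by
  have hs := contDiff_pi.1 hξ.1.1 0
  have hp : ∀ x, ξ (x + T) 0 = ξ x 0 := fun x => by rw [hξ.1.2]
  -- The weight is `ψ = ξ₀`, so the vanishing bracket reads `∫ ξ₀² = 0`.
  have h1 := geometricBracket_weightedLength hT hk
    (hξ.2 _ (isFunctional_weightedLength hs hp) _ (hasVarDerivInv_weightedLength hs hp k))
  simp only [Fin.sum_univ_three, Matrix.cons_val_zero, Matrix.cons_val_one, Matrix.cons_val,
    zero_mul, add_zero] at h1
  have h2 := eq_zero_of_integral_eq_zero hT (f := fun x => ξ x 0 * ξ x 0)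
    (hs.mul hs).continuous (fun x => mul_self_nonneg _) (fun x => by simp only [hp]) h1 x
  exact mul_self_eq_zero.1 h2

/-- If the invariants of a family move by a Hamiltonian vector, the arc-length is stationary. -/
theorem InvariantsHamiltonianAt.hasDerivAt_arcLength {T : ℝ} (hT : 0 < T)
    {h : (ℝ → Fin 3 → ℝ) → ℝ} {I : Set ℝ} {u : ℝ → ℝ → Vec} (hu : IsFlow T I u) {t : ℝ}
    (ht : t ∈ I) (hH : InvariantsHamiltonianAt T h u t) (x : ℝ) :
    HasDerivAt (fun s => arcLength (u s) x) 0 t := by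
  obtain ⟨ξ, hξ, hd⟩ := hH
  have h1 := hd x 0
  rw [hξ.zero_component hT (hu.curve t ht).invariants_mem] at h1
  refine h1.congr_of_eventuallyEq ?_
  -- Differentiating in time needs `k₀ = ‖u'‖` at all nearby times, which openness of `I` supplies.
  filter_upwards [hu.isOpen.mem_nhds ht] with s hs
  exact ((hu.curve s hs).invariants_zero x).symm

end LightCone

end

theorem mainTheorem8 (T : ℝ) (hT : 0 < T) (n : ℕ)
    (F : (Fin (n + 1) → LightCone.Vec) → LightCone.Vec)
    (hF : LightCone.IsInvariantEvolution T F) :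
    (LightCone.InducesHamiltonianEvolution T F → LightCone.PreservesArcLength T F) ∧
      (LightCone.InducesHamiltonianField T F → LightCone.FieldPreservesArcLength T F) := by
  constructor
  · rintro ⟨h, -, hh⟩ I u hu s hs t ht x
    have hd : ∀ r ∈ I, HasDerivAt (fun s => LightCone.arcLength (u s) x) 0 r := fun r hr =>
      (hh I u hu r hr).hasDerivAt_arcLength hT hu.1 hr x
    exact hu.1.isOpen.is_const_of_deriv_eq_zero hu.1.ordConnected.isPreconnected
      (fun r hr => (hd r hr).differentiableAt.differentiableWithinAt)
      (fun r hr => (hd r hr).deriv) hs ht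
  · rintro ⟨h, -, hh⟩ I u hu t ht he x
    exact (hh I u hu t ht he).hasDerivAt_arcLength hT hu ht x
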